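/- Fix a constant $c\ge 1$ and put $|(y,p)|:=|y|+p+c$ for $(y,p)\in\{0,1\}^*\times\mathbb N$. Let $L\subseteq\{0,1\}^*$ be any problem and let $R\subseteq\{0,1\}^*\times\mathbb N$ be any parameterized problem. Suppose that there is an oracle OR distillation of $L$ into $R$, that is, a deterministic polynomial-time algorithm $\mathcal A$ with oracle access to $R$ and some $\varepsilon>0$ such that, on every sequence $x_1,\dots,x_t\in\{0,1\}^*$ with $t\ge 1$ (running time polynomial in the encoding length $\Theta(\sum_{i}(|x_i|+1))$ of the sequence), - the queries $(y_1,p_1),\dots,(y_s,p_s)$ that $\mathcal A$ makes to the oracle, adaptively and counted with repetition, have total size $$\sum_{i=1}^{s}|(y_i,p_i)|\le t^{1-\varepsilon}\cdot\mathrm{poly}\bigl(\max_{1\le i\le t}|x_i|\bigr),$$ where the polynomial does not depend on $t$ or on the $x_i$, and - $\mathcal A$ answers "Yes" if and only if $x_i\in L$ for at least one $i\in\{1,\dots,t\}$. Then $L\in\mathrm{coNP}/\mathrm{poly}$, that is, there are a problem $A\in\mathrm{coNP}$ and advice strings $a_0,a_1,\ldots\in\{0,1\}^*$ with $|a_n|\le\mathrm{poly}(n)$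 such that, for every $x\in\{0,1\}^*$, $x\in L$ if and only if $\langle x,a_{|x|}\rangle\in A$. -/

import Mathlib

/-!
Binary strings are `List Bool`, a classical problem is a `Set (List Bool)`, and a parameterized
problem is a `Set (List Bool × ℕ)`.

Algorithms are run on finite-control machines with finitely many binary stacks, one symbol per
stack and step. Two stacks are a two-way tape, and `m` parallel binary stacks are one stack over
an alphabet of `2 ^ m` symbols, so these are multitape Turing machines up to constant factors in
the running time.
-/

namespace OracleOR

/-- The length of the longest string in a list. -/
def maxLength (xs : List (List Bool)) : ℕ :=
  (xs.map List.length).foldr max 0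

/-! ### Encodings -/

/-- Self-delimiting code of a string: every bit is preceded by `1`, and a `0` ends the code. -/
def delimit (x : List Bool) : List Bool :=
  x.flatMap (fun b => [true, b]) ++ [false]

/-- The input encoding of a sequence of strings. Its length is `∑ i, (2 * |x i| + 1)`. -/
def encodeSeq (xs : List (List Bool)) : List Bool :=
  xs.flatMap delimit

/-- The encoding of an ordered pair of strings. -/
def pair (x a : List Bool) : List Bool :=
  delimit x ++ a

/-- The size `|(y, p)| = |y| + p + c` of an instance of a parameterized problem, where `c` is the
constant overhead of writing down a pair. -/
def instanceSize (c : ℕ) (q : List Bool × ℕ) : ℕ :=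
  q.1.length + q.2 + c

/-! ### Stacks -/

/-- What a machine can do to one stack in one step. -/
inductive StackOp
  | keep : StackOp
  | pop : StackOp
  | push : Bool → StackOp

/-- The effect of a stack operation; popping the empty stack does nothing. -/
def StackOp.apply : StackOp → List Bool → List Bool
  | .keep, l => l
  | .pop, l => l.tail
  | .push b, l => b :: l

/-! ### Deterministic oracle machines -/

/-- The instructions of a deterministic oracle machine. Besides its stacks the machine has a
write-only oracle tape that holds a query `(y, p)`, the parameter `p` being written in unary. -/
inductive Instr (State Stack : Type)
  /-- Apply an operation to every stack and change the state. -/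
  | act : State → (Stack → StackOp) → Instr State Stack
  /-- Append a bit to the string `y` on the oracle tape. -/
  | write : Bool → State → Instr State Stack
  /-- Increase the parameter `p` on the oracle tape by one. -/
  | incr : State → Instr State Stack
  /-- Query the oracle with `(y, p)`, go to the first state if the answer is yes and to the second
  one otherwise, and erase the oracle tape. -/
  | ask : State → State → Instr State Stack
  /-- Stop and return yes (`true`) or no (`false`). -/
  | halt : Bool → Instr State Stack

/-- A deterministic oracle machine: the next instruction is a function of the control state and
of the top symbols of the stacks (`none` for an empty stack). -/
structure OracleMachine where
  State : Type
  [finState : Finite State]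
  Stack : Type
  [finStack : Finite Stack]
  [decStack : DecidableEq Stack]
  /-- the stack that holds the input at the start -/
  input : Stack
  start : State
  program : State → (Stack → Option Bool) → Instr State Stack

namespace OracleMachine

attribute [instance] finState finStack decStack

/-- A configuration: control state, stacks, and the query `(y, p)` on the oracle tape. -/
structure Config (M : OracleMachine) where
  state : M.State
  stack : M.Stack → List Bool
  y : List Bool
  p : ℕ

/-- The instruction that is carried out in a configuration. -/
def Config.instr {M : OracleMachine} (C : M.Config) : Instr M.State M.Stack :=
  M.program C.state (fun s => (C.stack s).head?)

/-- The initial configuration: the input `w` on the input stack with its first symbol on top, all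
other stacks and the oracle tape empty. -/
def init (M : OracleMachine) (w : List Bool) : M.Config :=
  ⟨M.start, Function.update (fun _ => []) M.input w, [], 0⟩

/-- `M.Run R C k qs b`: with oracle `R`, the machine started in the configuration `C` halts after
`k` steps with answer `b`, and `qs` is the sequence of all queries that it makes on the way. -/
inductive Run (M : OracleMachine) (R : Set (List Bool × ℕ)) :
    M.Config → ℕ → List (List Bool × ℕ) → Bool → Prop
  | halt (C : M.Config) (b : Bool) (h : C.instr = .halt b) : Run M R C 1 [] b
  | act (C : M.Config) (s : M.State) (ops : M.Stack → StackOp) (k : ℕ)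
      (qs : List (List Bool × ℕ)) (b : Bool) (h : C.instr = .act s ops)
      (hr : Run M R ⟨s, fun i => (ops i).apply (C.stack i), C.y, C.p⟩ k qs b) :
      Run M R C (k + 1) qs b
  | write (C : M.Config) (d : Bool) (s : M.State) (k : ℕ)
      (qs : List (List Bool × ℕ)) (b : Bool) (h : C.instr = .write d s)
      (hr : Run M R ⟨s, C.stack, C.y ++ [d], C.p⟩ k qs b) :
      Run M R C (k + 1) qs b
  | incr (C : M.Config) (s : M.State) (k : ℕ)
      (qs : List (List Bool × ℕ)) (b : Bool) (h : C.instr = .incr s)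
      (hr : Run M R ⟨s, C.stack, C.y, C.p + 1⟩ k qs b) :
      Run M R C (k + 1) qs b
  | askYes (C : M.Config) (s t : M.State) (k : ℕ)
      (qs : List (List Bool × ℕ)) (b : Bool) (h : C.instr = .ask s t) (hq : (C.y, C.p) ∈ R)
      (hr : Run M R ⟨s, C.stack, [], 0⟩ k qs b) :
      Run M R C (k + 1) ((C.y, C.p) :: qs) b
  | askNo (C : M.Config) (s t : M.State) (k : ℕ)
      (qs : List (List Bool × ℕ)) (b : Bool) (h : C.instr = .ask s t) (hq : (C.y, C.p) ∉ R)
      (hr : Run M R ⟨t, C.stack, [], 0⟩ k qs b) :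
      Run M R C (k + 1) ((C.y, C.p) :: qs) b

end OracleMachine

/-- `M` is an oracle OR distillation of `L` into `R`, instance sizes being taken with the
constant `c`: for some `ε > 0`, on all sequences `x₁, …, x_t` with `t ≥ 1`, the machine runs in
polynomial time, its queries have total size at most `t ^ (1 - ε) * poly (max |x_i|)`, and it
answers yes if and only if some `x_i` is in `L`. -/
def IsOracleORDistillation (c : ℕ) (M : OracleMachine) (L : Set (List Bool))
    (R : Set (List Bool × ℕ)) : Prop :=
  ∃ ε : ℝ, 0 < ε ∧ ∃ sizeBound timeBound : Polynomial ℕ,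
    ∀ xs : List (List Bool), xs ≠ [] →
      ∃ (k : ℕ) (qs : List (List Bool × ℕ)) (b : Bool),
        M.Run R (M.init (encodeSeq xs)) k qs b ∧
        k ≤ timeBound.eval (encodeSeq xs).length ∧
        (((qs.map (instanceSize c)).sum : ℕ) : ℝ) ≤
          (xs.length : ℝ) ^ (1 - ε) * ((sizeBound.eval (maxLength xs) : ℕ) : ℝ) ∧
        (b = true ↔ ∃ x ∈ xs, x ∈ L)

/-! ### Nondeterministic machines and complexity classes -/

/-- A nondeterministic machine: the control state and the top symbols of the stacks determine the
(finite) set of possible moves. -/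
structure NMachine where
  State : Type
  [finState : Finite State]
  Stack : Type
  [finStack : Finite Stack]
  [decStack : DecidableEq Stack]
  /-- the stack that holds the input at the start -/
  input : Stack
  start : State
  accept : State
  moves : State → (Stack → Option Bool) → Set (State × (Stack → StackOp))

namespace NMachine

attribute [instance] finState finStack decStack

/-- A configuration: control state and stacks. -/
structure Config (N : NMachine) where
  state : N.State
  stack : N.Stack → List Bool

/-- The initial configuration: the input on the input stack with its first symbol on top, all
other stacks empty. -/
def init (N : NMachine) (w : List Bool) : N.Config :=
  ⟨N.start, Function.update (fun _ => []) N.input w⟩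

/-- One step of a computation. -/
def Step (N : NMachine) (C D : N.Config) : Prop :=
  ∃ ops : N.Stack → StackOp,
    (D.state, ops) ∈ N.moves C.state (fun s => (C.stack s).head?) ∧
    D.stack = fun i => (ops i).apply (C.stack i)

/-- `N.AcceptsIn k C`: some computation of `k` steps leads from `C` to the accepting state. -/
inductive AcceptsIn (N : NMachine) : ℕ → N.Config → Prop
  | done (C : N.Config) (h : C.state = N.accept) : AcceptsIn N 0 C
  | step (C D : N.Config) (k : ℕ) (h : N.Step C D) (hr : AcceptsIn N k D) :
      AcceptsIn N (k + 1) C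

end NMachine

/-- `NP`: the problems `A` with a nondeterministic machine `N` and a polynomial `p` such that the
members `w` of `A` are exactly the inputs that `N` accepts by a computation of at most `p (|w|)`
steps. -/
def NP : Set (Set (List Bool)) :=
  {A | ∃ (N : NMachine) (p : Polynomial ℕ), ∀ w : List Bool,
    w ∈ A ↔ ∃ k ≤ p.eval w.length, N.AcceptsIn k (N.init w)}

/-- `coNP`: the problems whose complement is in `NP`. -/
def coNP : Set (Set (List Bool)) :=
  {A | Aᶜ ∈ NP}

/-- `𝒞/poly`: the problems that a problem in `𝒞` decides with the help of an advice string of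
polynomial length that depends only on the length of the input. -/
def slashPoly (𝒞 : Set (Set (List Bool))) : Set (Set (List Bool)) :=
  {L | ∃ A ∈ 𝒞, ∃ (advice : ℕ → List Bool) (p : Polynomial ℕ),
    (∀ n, (advice n).length ≤ p.eval n) ∧
    ∀ x : List Bool, x ∈ L ↔ pair x (advice x.length) ∈ A}

end OracleOR

namespace OracleOR

/-! ### Polynomials and lengths -/

/-! A run of the distillation is determined by its input and the transcript of its queries with
their answers. For length `n`, feed it tuples of `t` no-instances of length `n`, with `t` a
polynomial in `n` so large that `t ^ (1 - ε) * poly n < t / 3`. Every transcript then has fewer than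
`t` bits, so there are fewer than `2 ^ t` of them.

Pigeonhole (`exists_half_covered`): some transcript is shared by tuples whose entries make up at
least half of the no-instances. Removing these and repeating (`exists_cover`) leaves nothing after
`n + 1` rounds, and the advice is the concatenation of the transcripts found.

To certify `x ∉ L`, guess a sequence that contains `x` and a place in the advice, and simulate `M`,
taking the answers from the records there; accept if it says no. Every no-instance has such a
certificate (`acceptsIn_pair`). Conversely, records state true facts about `R` and are used only for
matching queries, so an accepted simulation is a genuine run with answer no, and no string of the
guessed sequence is in `L` (`of_acceptsIn`). `R` need not be decidable. -/

theorem eval_le_eval (p : Polynomial ℕ) {m n : ℕ} (h : m ≤ n) : p.eval m ≤ p.eval n := by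
  rw [Polynomial.eval_eq_sum_range, Polynomial.eval_eq_sum_range]
  gcongr

theorem maxLength_le {xs : List (List Bool)} {n : ℕ} (h : ∀ x ∈ xs, x.length ≤ n) :
    maxLength xs ≤ n := by
  induction xs with
  | nil => simp [maxLength]
  | cons x xs ih =>
    have h₁ := ih fun y hy => h y (by simp [hy])
    have h₂ := h x (by simp)
    simp only [maxLength, List.map_cons, List.foldr_cons] at h₁ ⊢
    exact max_le h₂ h₁

@[simp] theorem delimit_nil : delimit [] = [false] := rfl

@[simp] theorem delimit_cons (b : Bool) (x : List Bool) :
    delimit (b :: x) = true :: b :: delimit x := rfl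

theorem length_delimit (x : List Bool) : (delimit x).length = 2 * x.length + 1 := by
  induction x with
  | nil => rfl
  | cons b x ih => simp [ih]; ring

theorem encodeSeq_append (xs ys : List (List Bool)) :
    encodeSeq (xs ++ ys) = encodeSeq xs ++ encodeSeq ys := by
  simp [encodeSeq]

@[simp] theorem encodeSeq_cons (x : List Bool) (xs : List (List Bool)) :
    encodeSeq (x :: xs) = delimit x ++ encodeSeq xs := rfl

@[simp] theorem encodeSeq_nil : encodeSeq [] = [] := rfl

theorem length_le_encodeSeq (xs : List (List Bool)) : xs.length ≤ (encodeSeq xs).length := by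
  induction xs with
  | nil => simp
  | cons x xs ih => simp [length_delimit]; omega

theorem length_encodeSeq {xs : List (List Bool)} {n : ℕ} (h : ∀ x ∈ xs, x.length = n) :
    (encodeSeq xs).length = xs.length * (2 * n + 1) := by
  induction xs with
  | nil => simp
  | cons x xs ih =>
    simp [length_delimit, ih fun y hy => h y (by simp [hy]), h x (by simp)]
    ring

/-- The code of a string without its end marker. -/
def codeBits (x : List Bool) : List Bool :=
  x.flatMap fun b => [true, b]

@[simp] theorem codeBits_nil : codeBits [] = [] := rfl

@[simp] theorem codeBits_cons (b : Bool) (x : List Bool) :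
    codeBits (b :: x) = true :: b :: codeBits x := rfl

@[simp] theorem codeBits_append (x y : List Bool) :
    codeBits (x ++ y) = codeBits x ++ codeBits y := by
  simp [codeBits]

theorem delimit_eq (x : List Bool) : delimit x = codeBits x ++ [false] := rfl

/-! ### Runs of oracle machines are deterministic -/

/-- Soundness produces a run from a simulation, while the distillation property speaks of some run
of its own; this identifies their answers. -/
theorem OracleMachine.Run.unique {M : OracleMachine} {R : Set (List Bool × ℕ)} {C : M.Config}
    {k k' : ℕ} {qs qs' : List (List Bool × ℕ)} {b b' : Bool} (h : M.Run R C k qs b)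
    (h' : M.Run R C k' qs' b') : b = b' := by
  induction h generalizing k' qs' with
  | halt C b h => cases h' <;> simp_all
  | act C s ops k qs b h hr ih =>
    cases h' <;> simp_all
    exact ih ‹_›
  | write C d s k qs b h hr ih =>
    cases h' <;> simp_all
    exact ih ‹_›
  | incr C s k qs b h hr ih =>
    cases h' <;> simp_all
    exact ih ‹_›
  | askYes C s t k qs b h hq hr ih =>
    cases h' <;> simp_all
    exact ih ‹_›
  | askNo C s t k qs b h hq hr ih =>
    cases h' <;> simp_all
    exact ih ‹_›

/-! ### Transcripts -/

open Classical in
/-- The record of a query together with its answer. -/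
noncomputable def record (R : Set (List Bool × ℕ)) (q : List Bool × ℕ) : List Bool :=
  -- Reversed because the verifier keeps the query on a stack, with the last bit written on top.
  delimit q.1.reverse ++ (List.replicate q.2 true ++ [false, decide (q ∈ R)])

/-- The records of a sequence of queries. -/
noncomputable def transcript (R : Set (List Bool × ℕ)) (qs : List (List Bool × ℕ)) : List Bool :=
  qs.flatMap (record R)

theorem transcript_cons (R : Set (List Bool × ℕ)) (q : List Bool × ℕ)
    (qs : List (List Bool × ℕ)) : transcript R (q :: qs) = record R q ++ transcript R qs := rfl

theorem transcript_append (R : Set (List Bool × ℕ)) (qs qs' : List (List Bool × ℕ)) :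
    transcript R (qs ++ qs') = transcript R qs ++ transcript R qs' := by
  simp [transcript]

theorem length_record (R : Set (List Bool × ℕ)) (q : List Bool × ℕ) :
    (record R q).length = 2 * q.1.length + q.2 + 3 := by
  simp [record, length_delimit]; omega

/-- Since `c ≥ 1`, the three bits of overhead per record are paid for by `3 * c`; even an empty
query has positive size. -/
theorem length_transcript_le {c : ℕ} (hc : 1 ≤ c) (R : Set (List Bool × ℕ))
    (qs : List (List Bool × ℕ)) :
    (transcript R qs).length ≤ 3 * (qs.map (instanceSize c)).sum := by
  induction qs with
  | nil => simp [transcript]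
  | cons q qs ih =>
    simp only [transcript_cons, List.length_append, length_record, List.map_cons, List.sum_cons,
      instanceSize] at ih ⊢
    omega

/-! ### The verifier -/

/-- The control states of the verifier for an oracle machine with control states `Q`. -/
inductive VState (Q : Type)
  /-- The buffer holds codes of complete strings; the flag tells whether the input string is
  already among them. -/
  | boundary : Bool → VState Q
  /-- A string is being guessed. -/
  | guess : Bool → VState Q
  /-- A bit of a string is about to be guessed. -/
  | guessBit : Bool → VState Q
  /-- The input string is being copied to the buffer. -/
  | copy : VState Q
  | copyBit : VState Q
  /-- The buffer is being moved to the input stack of the oracle machine. -/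
  | load : VState Q
  /-- Records may be skipped before the simulation starts. -/
  | ready : VState Q
  /-- The next record is being compared with the query; the argument holds the two possible
  continuations of the simulation, if it has started. -/
  | fetch : Option (Q × Q) → VState Q
  | fetchBit : Option (Q × Q) → VState Q
  | fetchParam : Option (Q × Q) → VState Q
  | fetchAnswer : Option (Q × Q) → VState Q
  /-- The oracle machine is being simulated. -/
  | sim : Q → VState Q
  | accept : VState Q

instance (Q : Type) [Finite Q] : Finite (VState Q) := by
  let f : (Bool ⊕ Bool ⊕ Bool) ⊕ Fin 5 ⊕ (Fin 4 × Option (Q × Q)) ⊕ Q → VState Q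
    | .inl (.inl d) => .boundary d
    | .inl (.inr (.inl d)) => .guess d
    | .inl (.inr (.inr d)) => .guessBit d
    | .inr (.inl 0) => .copy
    | .inr (.inl 1) => .copyBit
    | .inr (.inl 2) => .load
    | .inr (.inl 3) => .ready
    | .inr (.inl 4) => .accept
    | .inr (.inr (.inl (0, m))) => .fetch m
    | .inr (.inr (.inl (1, m))) => .fetchBit m
    | .inr (.inr (.inl (2, m))) => .fetchParam m
    | .inr (.inr (.inl (3, m))) => .fetchAnswer m
    | .inr (.inr (.inr q)) => .sim q
  refine Finite.of_surjective f fun q => ?_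
  cases q with
  | boundary d => exact ⟨.inl (.inl d), rfl⟩
  | guess d => exact ⟨.inl (.inr (.inl d)), rfl⟩
  | guessBit d => exact ⟨.inl (.inr (.inr d)), rfl⟩
  | copy => exact ⟨.inr (.inl 0), rfl⟩
  | copyBit => exact ⟨.inr (.inl 1), rfl⟩
  | load => exact ⟨.inr (.inl 2), rfl⟩
  | ready => exact ⟨.inr (.inl 3), rfl⟩
  | accept => exact ⟨.inr (.inl 4), rfl⟩
  | fetch m => exact ⟨.inr (.inr (.inl (0, m))), rfl⟩
  | fetchBit m => exact ⟨.inr (.inr (.inl (1, m))), rfl⟩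
  | fetchParam m => exact ⟨.inr (.inr (.inl (2, m))), rfl⟩
  | fetchAnswer m => exact ⟨.inr (.inr (.inl (3, m))), rfl⟩
  | sim q => exact ⟨.inr (.inr (.inr q)), rfl⟩

/-- Where the verifier for `M` goes on after an answer has been read. -/
def afterAnswer (M : OracleMachine) (m : Option (M.State × M.State)) (b : Bool) :
    VState M.State :=
  match m with
  | none => .ready
  | some (s, t) => .sim (if b then s else t)

/-- The moves of the verifier for `M`. Besides the stacks of `M`, it has an input stack, a stack
that serves as buffer and holds the string of the next query, and one for its parameter. The
parameters of this predicate are the top symbols, the indices are the state, the next state, and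
the operations on the stacks. -/
inductive Move (M : OracleMachine) (S : M.Stack → Option Bool) (a r u : Option Bool) :
    VState M.State → VState M.State → (M.Stack → StackOp) → StackOp → StackOp → StackOp → Prop
  | guessString (d : Bool) :
      Move M S a r u (.boundary d) (.guess d) (fun _ => .keep) .keep .keep .keep
  | guessMore (d : Bool) :
      Move M S a r u (.guess d) (.guessBit d) (fun _ => .keep) .keep (.push true) .keep
  | guessBit (d b : Bool) :
      Move M S a r u (.guessBit d) (.guess d) (fun _ => .keep) .keep (.push b) .keep
  | guessEnd (d : Bool) :
      Move M S a r u (.guess d) (.boundary d) (fun _ => .keep) .keep (.push false) .keep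
  | copyString : Move M S a r u (.boundary false) .copy (fun _ => .keep) .keep .keep .keep
  | copyMore (h : a = some true) :
      Move M S a r u .copy .copyBit (fun _ => .keep) .pop (.push true) .keep
  | copyBit (b : Bool) (h : a = some b) :
      Move M S a r u .copyBit .copy (fun _ => .keep) .pop (.push b) .keep
  | copyEnd (h : a = some false) :
      Move M S a r u .copy (.boundary true) (fun _ => .keep) .pop (.push false) .keep
  | startLoad : Move M S a r u (.boundary true) .load (fun _ => .keep) .keep .keep .keep
  | load (b : Bool) (h : r = some b) :
      Move M S a r u .load .load (Function.update (fun _ => .keep) M.input (.push b))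
        .keep .pop .keep
  | loadEnd (h : r = none) : Move M S a r u .load .ready (fun _ => .keep) .keep .keep .keep
  -- A record is skipped by guessing its query and fetching the answer as in the simulation, so one
  -- comparison routine serves both purposes.
  | skipBit (b : Bool) : Move M S a r u .ready .ready (fun _ => .keep) .keep (.push b) .keep
  | skipParam : Move M S a r u .ready .ready (fun _ => .keep) .keep .keep (.push true)
  | skip : Move M S a r u .ready (.fetch none) (fun _ => .keep) .keep .keep .keep
  | startSim (hr : r = none) (hu : u = none) :
      Move M S a r u .ready (.sim M.start) (fun _ => .keep) .keep .keep .keep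
  | fetchMore (m : Option (M.State × M.State)) (h : a = some true) :
      Move M S a r u (.fetch m) (.fetchBit m) (fun _ => .keep) .pop .keep .keep
  -- On a mismatch there is no move, and the branch dies without accepting.
  | fetchBit (m : Option (M.State × M.State)) (b : Bool) (ha : a = some b) (hr : r = some b) :
      Move M S a r u (.fetchBit m) (.fetch m) (fun _ => .keep) .pop .pop .keep
  | fetchEnd (m : Option (M.State × M.State)) (ha : a = some false) (hr : r = none) :
      Move M S a r u (.fetch m) (.fetchParam m) (fun _ => .keep) .pop .keep .keep
  | fetchParam (m : Option (M.State × M.State)) (ha : a = some true) (hu : u ≠ none) :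
      Move M S a r u (.fetchParam m) (.fetchParam m) (fun _ => .keep) .pop .keep .pop
  | fetchParamEnd (m : Option (M.State × M.State)) (ha : a = some false) (hu : u = none) :
      Move M S a r u (.fetchParam m) (.fetchAnswer m) (fun _ => .keep) .pop .keep .keep
  | fetchAnswer (m : Option (M.State × M.State)) (b : Bool) (ha : a = some b) :
      Move M S a r u (.fetchAnswer m) (afterAnswer M m b) (fun _ => .keep) .pop .keep .keep
  | act (q s : M.State) (ops : M.Stack → StackOp) (h : M.program q S = .act s ops) :
      Move M S a r u (.sim q) (.sim s) ops .keep .keep .keep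
  | write (q s : M.State) (d : Bool) (h : M.program q S = .write d s) :
      Move M S a r u (.sim q) (.sim s) (fun _ => .keep) .keep (.push d) .keep
  | incr (q s : M.State) (h : M.program q S = .incr s) :
      Move M S a r u (.sim q) (.sim s) (fun _ => .keep) .keep .keep (.push true)
  | ask (q s t : M.State) (h : M.program q S = .ask s t) :
      Move M S a r u (.sim q) (.fetch (some (s, t))) (fun _ => .keep) .keep .keep .keep
  | halt (q : M.State) (h : M.program q S = .halt false) :
      Move M S a r u (.sim q) .accept (fun _ => .keep) .keep .keep .keep

/-- On input `pair x a`, this machine guesses a sequence of strings that contains `x`, simulates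
`M` on it with the answers to the queries taken from `a`, and accepts if `M` says no. -/
def verifier (M : OracleMachine) : NMachine where
  State := VState M.State
  Stack := M.Stack ⊕ Fin 3
  input := .inr 0
  start := .boundary false
  accept := .accept
  moves q top := {m | Move M (fun i => top (.inl i)) (top (.inr 0)) (top (.inr 1)) (top (.inr 2))
    q m.1 (fun i => m.2 (.inl i)) (m.2 (.inr 0)) (m.2 (.inr 1)) (m.2 (.inr 2))}

/-- Combine data for the stacks of `M` and for the three other stacks of the verifier. -/
def join {σ α : Type} (S : σ → α) (a r u : α) : σ ⊕ Fin 3 → α :=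
  Sum.elim S ![a, r, u]

/-- The configuration of the verifier with the given state and stacks. -/
def vconfig (M : OracleMachine) (q : VState M.State) (S : M.Stack → List Bool)
    (a r u : List Bool) : (verifier M).Config :=
  ⟨q, join S a r u⟩

theorem init_verifier (M : OracleMachine) (w : List Bool) :
    (verifier M).init w = vconfig M (.boundary false) (fun _ => []) w [] [] := by
  simp only [NMachine.init, vconfig, verifier, join]
  congr 1
  funext i
  rcases i with i | i
  · exact Function.update_of_ne Sum.inl_ne_inr _ _
  · fin_cases i <;> simp [Function.update]

/-- Prepends one move to an accepting computation; the completeness lemmas therefore build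
computations from the end backwards. -/
theorem acceptsIn_of_move {M : OracleMachine} {q q' : VState M.State}
    {S : M.Stack → List Bool} {a r u : List Bool} {o : M.Stack → StackOp} {oa or ou : StackOp}
    (h : Move M (fun i => (S i).head?) a.head? r.head? u.head? q q' o oa or ou) {k : ℕ}
    (hk : (verifier M).AcceptsIn k (vconfig M q' (fun i => (o i).apply (S i)) (oa.apply a)
      (or.apply r) (ou.apply u))) :
    (verifier M).AcceptsIn (k + 1) (vconfig M q S a r u) := by
  refine .step _ (vconfig M q' _ _ _ _) _ ⟨join o oa or ou, h, ?_⟩ hk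
  funext i
  rcases i with i | i
  · rfl
  · fin_cases i <;> rfl

/-! ### Soundness -/

section Soundness

variable (M : OracleMachine) (R : Set (List Bool × ℕ)) (P : Prop) (x adv : List Bool)

/-- A run from the configuration with answer no would prove `P`. -/
def NoImplies (C : M.Config) : Prop :=
  ∀ k qs, M.Run R C k qs false → P

/-- Whatever the true answer to the query `q` is, the simulation may go on with it. -/
def AnswerOK (S : M.Stack → List Bool) (m : Option (M.State × M.State)) (q : List Bool × ℕ) :
    Prop :=
  match m with
  | none => NoImplies M R P ⟨M.start, S, [], 0⟩
  | some (s, t) => (q ∈ R → NoImplies M R P ⟨s, S, [], 0⟩) ∧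
      (q ∉ R → NoImplies M R P ⟨t, S, [], 0⟩)

/-- The state of the input stack while the sequence `xs` is being guessed. -/
def InputOK (d : Bool) (xs : List (List Bool)) (a : List Bool) : Prop :=
  if d then x ∈ xs ∧ a = adv else a = delimit x ++ adv

open Classical in
/-- What holds in the configurations that the verifier reaches on input `pair x adv`. -/
def Inv (q : VState M.State) (S : M.Stack → List Bool) (a r u : List Bool) : Prop :=
  match q with
  | .boundary d => (S = fun _ => []) ∧ ∃ xs, InputOK x adv d xs a ∧ r.reverse = encodeSeq xs
  | .guess d => (S = fun _ => []) ∧ ∃ xs z, InputOK x adv d xs a ∧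
      r.reverse = encodeSeq xs ++ codeBits z
  | .guessBit d => (S = fun _ => []) ∧ ∃ xs z, InputOK x adv d xs a ∧
      r.reverse = encodeSeq xs ++ codeBits z ++ [true]
  | .copy => (S = fun _ => []) ∧ ∃ xs z z', x = z ++ z' ∧ a = delimit z' ++ adv ∧
      r.reverse = encodeSeq xs ++ codeBits z
  | .copyBit => (S = fun _ => []) ∧ ∃ xs z b z', x = z ++ b :: z' ∧
      a = b :: (delimit z' ++ adv) ∧
      r.reverse = encodeSeq xs ++ codeBits z ++ [true]
  | .load => a = adv ∧ ∃ xs l, x ∈ xs ∧ S = Function.update (fun _ => []) M.input l ∧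
      r.reverse ++ l = encodeSeq xs
  | .ready => NoImplies M R P ⟨M.start, S, [], 0⟩ ∧ ∃ qs, a = transcript R qs
  -- If the advice is exhausted, the verifier is stuck. Otherwise `d` is the part already matched,
  -- common to the recorded query and the current one; the two coincide once `y` and `r` are both
  -- empty. In `.fetchParam`, `e` plays the same role for the parameter.
  | .fetch m => a = [] ∨ ∃ d y p qs, a = delimit y ++ (List.replicate p true ++
        false :: decide (((d ++ y).reverse, p) ∈ R) :: transcript R qs) ∧
      AnswerOK M R P S m ((d ++ r).reverse, u.length)
  | .fetchBit m => ∃ d b y p qs, a = b :: (delimit y ++ (List.replicate p true ++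
        false :: decide (((d ++ b :: y).reverse, p) ∈ R) :: transcript R qs)) ∧
      AnswerOK M R P S m ((d ++ r).reverse, u.length)
  | .fetchParam m => r = [] ∧ ∃ y e p qs, a = List.replicate p true ++
        false :: decide ((y, e + p) ∈ R) :: transcript R qs ∧
      AnswerOK M R P S m (y, e + u.length)
  | .fetchAnswer m => r = [] ∧ u = [] ∧ ∃ q qs, a = decide (q ∈ R) :: transcript R qs ∧
      AnswerOK M R P S m q
  | .sim q => NoImplies M R P ⟨q, S, r.reverse, u.length⟩ ∧ ∃ qs, a = transcript R qs
  | .accept => P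

variable {M R P x adv}

theorem inv_fetch {m : Option (M.State × M.State)} {S : M.Stack → List Bool}
    {a r u : List Bool} {qs : List (List Bool × ℕ)} (ha : a = transcript R qs)
    (h : AnswerOK M R P S m (r.reverse, u.length)) : Inv M R P x adv (.fetch m) S a r u := by
  cases qs with
  | nil => exact .inl ha
  | cons q qs => exact .inr ⟨[], q.1.reverse, q.2, qs, by simp [ha, transcript_cons, record], h⟩

-- `hM` and `hadv` enter only at `loadEnd`, where the simulated input is complete. The comparison
-- moves extend the matched part, so an answer is used only for the query it belongs to; the
-- simulation moves extend runs backwards by one step.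
open Classical in
theorem inv_of_move
    (hM : ∀ xs, x ∈ xs → NoImplies M R P (M.init (encodeSeq xs)))
    (hadv : ∃ qs, adv = transcript R qs)
    {q q' : VState M.State} {S : M.Stack → List Bool} {a r u : List Bool}
    {o : M.Stack → StackOp} {oa or ou : StackOp}
    (h : Move M (fun i => (S i).head?) a.head? r.head? u.head? q q' o oa or ou)
    (hI : Inv M R P x adv q S a r u) :
    Inv M R P x adv q' (fun i => (o i).apply (S i)) (oa.apply a) (or.apply r) (ou.apply u) := by
  cases h with
  | guessString d =>
    obtain ⟨hS, xs, hxs, hr⟩ := hI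
    exact ⟨hS, xs, [], hxs, by simpa [StackOp.apply] using hr⟩
  | guessMore d =>
    obtain ⟨hS, xs, z, hxs, hr⟩ := hI
    exact ⟨hS, xs, z, hxs, by simp [StackOp.apply, hr]⟩
  | guessBit d b =>
    obtain ⟨hS, xs, z, hxs, hr⟩ := hI
    exact ⟨hS, xs, z ++ [b], hxs, by simp [StackOp.apply, hr]⟩
  | guessEnd d =>
    obtain ⟨hS, xs, z, hxs, hr⟩ := hI
    refine ⟨hS, xs ++ [z], ?_, by simp [StackOp.apply, hr, encodeSeq_append, delimit_eq]⟩
    cases d <;> simp_all [InputOK, StackOp.apply]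
  | copyString =>
    obtain ⟨hS, xs, hxs, hr⟩ := hI
    exact ⟨hS, xs, [], x, rfl, hxs, by simpa [StackOp.apply] using hr⟩
  | copyMore h =>
    obtain ⟨hS, xs, z, z', hz, ha, hr⟩ := hI
    cases z' with
    | nil => simp [ha] at h
    | cons b z' => exact ⟨hS, xs, z, b, z', hz, by simp [ha, StackOp.apply],
        by simp [StackOp.apply, hr]⟩
  | copyBit b h =>
    obtain ⟨hS, xs, z, b', z', hz, ha, hr⟩ := hI
    obtain rfl : b' = b := by simpa [ha] using h
    exact ⟨hS, xs, z ++ [b'], z', by simp [hz], by simp [ha, StackOp.apply],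
      by simp [StackOp.apply, hr]⟩
  | copyEnd h =>
    obtain ⟨hS, xs, z, z', hz, ha, hr⟩ := hI
    cases z' with
    | cons b z' => simp [ha] at h
    | nil => exact ⟨hS, xs ++ [x], by simp [InputOK, ha, StackOp.apply],
        by simp_all [StackOp.apply, encodeSeq_append, delimit_eq]⟩
  | startLoad =>
    obtain ⟨hS, xs, ⟨hxs, ha⟩, hr⟩ := hI
    exact ⟨ha, xs, [], hxs, by simp [hS, StackOp.apply], by simpa [StackOp.apply] using hr⟩
  | load b h =>
    obtain ⟨ha, xs, l, hxs, hS, hr⟩ := hI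
    cases r with
    | nil => simp at h
    | cons b' r =>
      obtain rfl : b' = b := by simpa using h
      refine ⟨ha, xs, b' :: l, hxs, ?_, by simpa [StackOp.apply] using hr⟩
      funext i
      by_cases hi : i = M.input
      · subst hi; simp [hS, StackOp.apply]
      · simp [hS, hi, StackOp.apply]
  | loadEnd h =>
    obtain ⟨ha, xs, l, hxs, hS, hr⟩ := hI
    obtain rfl : r = [] := by simpa using h
    obtain rfl : l = encodeSeq xs := by simpa using hr
    obtain ⟨qs, rfl⟩ := hadv
    refine ⟨?_, qs, ha⟩
    have := hM xs hxs
    rwa [OracleMachine.init, ← hS] at this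
  | skipBit b => exact hI
  | skipParam => exact hI
  | skip =>
    obtain ⟨hS, qs, ha⟩ := hI
    exact inv_fetch ha hS
  | startSim hr hu =>
    obtain ⟨hS, ha⟩ := hI
    obtain rfl : r = [] := by simpa using hr
    obtain rfl : u = [] := by simpa using hu
    exact ⟨hS, ha⟩
  | fetchMore m h =>
    obtain ha | ⟨d, y, p, qs, ha, hA⟩ := hI
    · simp [ha] at h
    cases y with
    | nil => simp [ha] at h
    | cons b y => exact ⟨d, b, y, p, qs, by simp [ha, StackOp.apply], hA⟩
  | fetchBit m b h hr =>
    obtain ⟨d, b', y, p, qs, ha, hA⟩ := hI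
    obtain rfl : b' = b := by simpa [ha] using h
    cases r with
    | nil => simp at hr
    | cons b r =>
      obtain rfl : b = b' := by simpa using hr
      refine .inr ⟨d ++ [b], y, p, qs, by simp [ha, StackOp.apply], ?_⟩
      simpa [StackOp.apply] using hA
  | fetchEnd m h hr =>
    obtain ha | ⟨d, y, p, qs, ha, hA⟩ := hI
    · simp [ha] at h
    obtain rfl : r = [] := by simpa using hr
    cases y with
    | cons b y => simp [ha] at h
    | nil =>
      exact ⟨rfl, d.reverse, 0, p, qs, by simp [ha, StackOp.apply],
        by simpa [StackOp.apply] using hA⟩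
  | fetchParam m h hu =>
    obtain ⟨hr, y, e, p, qs, ha, hA⟩ := hI
    cases p with
    | zero => simp [ha] at h
    | succ p =>
      cases u with
      | nil => simp at hu
      | cons b u =>
        refine ⟨hr, y, e + 1, p, qs, ?_, ?_⟩
        · simp [ha, StackOp.apply, List.replicate_succ, add_assoc, add_comm 1]
        · simpa [StackOp.apply, add_assoc, add_comm 1] using hA
  | fetchParamEnd m h hu =>
    obtain ⟨hr, y, e, p, qs, ha, hA⟩ := hI
    obtain rfl : u = [] := by simpa using hu
    cases p with
    | succ p => simp [ha, List.replicate_succ] at h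
    | zero => exact ⟨hr, rfl, (y, e), qs, by simp [ha, StackOp.apply], hA⟩
  | fetchAnswer m b h =>
    obtain ⟨rfl, rfl, q, qs, ha, hA⟩ := hI
    obtain rfl : decide (q ∈ R) = b := by simpa [ha] using h
    have ha' : StackOp.pop.apply a = transcript R qs := by simp [ha, StackOp.apply]
    rcases m with _ | ⟨s, t⟩
    · exact ⟨hA, qs, ha'⟩
    · refine ⟨?_, qs, ha'⟩
      by_cases hq : q ∈ R
      · simpa [hq, StackOp.apply] using hA.1 hq
      · simpa [hq, StackOp.apply] using hA.2 hq
  | act q s ops h =>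
    obtain ⟨hS, ha⟩ := hI
    exact ⟨fun k qs hr => hS _ _ (.act _ _ _ _ _ _ h hr), ha⟩
  | write q s d h =>
    obtain ⟨hS, ha⟩ := hI
    refine ⟨fun k qs hr => hS (k + 1) qs (.write _ d s _ _ _ h ?_), ha⟩
    simpa [StackOp.apply] using hr
  | incr q s h =>
    obtain ⟨hS, ha⟩ := hI
    exact ⟨fun k qs hr => hS _ _ (.incr _ _ _ _ _ h hr), ha⟩
  | ask q s t h =>
    obtain ⟨hS, qs, ha⟩ := hI
    exact inv_fetch ha ⟨fun hq k qs hr => hS _ _ (.askYes _ _ _ _ _ _ h hq hr),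
      fun hq k qs hr => hS _ _ (.askNo _ _ _ _ _ _ h hq hr)⟩
  | halt q h => exact hI.1 _ _ (.halt _ _ h)

theorem of_acceptsIn
    (hM : ∀ xs, x ∈ xs → NoImplies M R P (M.init (encodeSeq xs)))
    (hadv : ∃ qs, adv = transcript R qs) {k : ℕ}
    (h : (verifier M).AcceptsIn k ((verifier M).init (pair x adv))) : P := by
  -- Induction needs an arbitrary configuration satisfying the invariant; at `.accept` the invariant
  -- is `P` itself.
  suffices H : ∀ k C, (verifier M).AcceptsIn k C →
      Inv M R P x adv C.state (fun i => C.stack (.inl i)) (C.stack (.inr 0)) (C.stack (.inr 1))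
        (C.stack (.inr 2)) → P by
    refine H _ _ h ?_
    rw [init_verifier]
    exact ⟨rfl, [], rfl, rfl⟩
  clear h
  intro k C hC
  induction hC with
  | done C h =>
    intro hI
    have h' : C.state = VState.accept := h
    rw [h'] at hI
    exact hI
  | step C D k h hr ih =>
    intro hI
    obtain ⟨ops, hm, hD⟩ := h
    refine ih ?_
    rw [hD]
    exact inv_of_move hM hadv hm hI

end Soundness

/-! ### Completeness -/

section Completeness

variable {M : OracleMachine} {S : M.Stack → List Bool} {a r u : List Bool} {j : ℕ}

theorem acceptsIn_fetch {m : Option (M.State × M.State)} (y : List Bool)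
    (h : (verifier M).AcceptsIn j (vconfig M (.fetchParam m) S a [] u)) :
    (verifier M).AcceptsIn (j + (delimit y).length)
      (vconfig M (.fetch m) S (delimit y ++ a) y u) := by
  induction y with
  | nil => exact acceptsIn_of_move (.fetchEnd m rfl rfl) h
  | cons b y ih =>
    exact acceptsIn_of_move (.fetchMore m rfl) (acceptsIn_of_move (.fetchBit m b rfl rfl) ih)

theorem acceptsIn_fetchParam {m : Option (M.State × M.State)} {b : Bool} (p : ℕ)
    (h : (verifier M).AcceptsIn j (vconfig M (afterAnswer M m b) S a [] [])) :
    (verifier M).AcceptsIn (j + 2 + p)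
      (vconfig M (.fetchParam m) S (List.replicate p true ++ false :: b :: a) []
        (List.replicate p true)) := by
  induction p with
  | zero =>
    exact acceptsIn_of_move (.fetchParamEnd m rfl rfl)
      (acceptsIn_of_move (.fetchAnswer m b rfl) h)
  | succ p ih =>
    exact acceptsIn_of_move (.fetchParam m rfl (by simp [List.replicate_succ])) ih

open Classical in
theorem acceptsIn_record {m : Option (M.State × M.State)} (R : Set (List Bool × ℕ))
    (q : List Bool × ℕ)
    (h : (verifier M).AcceptsIn j (vconfig M (afterAnswer M m (decide (q ∈ R))) S a [] [])) :
    (verifier M).AcceptsIn (j + (record R q).length)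
      (vconfig M (.fetch m) S (record R q ++ a) q.1.reverse (List.replicate q.2 true)) := by
  have := acceptsIn_fetch q.1.reverse (acceptsIn_fetchParam q.2 h)
  convert this using 1
  · simp [record]; omega
  · simp [record]

/-- One step per step of `M` and one per symbol of the records read; the rest `a` of the advice
stays unread. The answer is kept a variable, with `hb` separate, for the induction on the run. -/
theorem acceptsIn_sim {R : Set (List Bool × ℕ)} {C : M.Config} {k : ℕ}
    {qs : List (List Bool × ℕ)} {b : Bool} (h : M.Run R C k qs b) (hb : b = false) :
    (verifier M).AcceptsIn (k + (transcript R qs).length)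
      (vconfig M (.sim C.state) C.stack (transcript R qs ++ a) C.y.reverse
        (List.replicate C.p true)) := by
  induction h with
  | halt C b h =>
    subst hb
    exact acceptsIn_of_move (.halt _ h) (.done _ rfl)
  | act C s ops k qs b h hr ih =>
    rw [add_right_comm]
    exact acceptsIn_of_move (.act _ s ops h) (ih hb)
  | write C d s k qs b h hr ih =>
    rw [add_right_comm]
    refine acceptsIn_of_move (.write _ s d h) ?_
    simpa [StackOp.apply] using ih hb
  | incr C s k qs b h hr ih =>
    rw [add_right_comm]
    exact acceptsIn_of_move (.incr _ s h) (ih hb)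
  | askYes C s t k qs b h hq hr ih =>
    have := acceptsIn_record (m := some (s, t)) R (C.y, C.p) (by simpa [afterAnswer, hq] using ih hb)
    rw [transcript_cons, List.length_append, List.append_assoc, add_right_comm k 1,
      add_comm (record _ _).length, ← add_assoc]
    exact acceptsIn_of_move (.ask _ s t h) this
  | askNo C s t k qs b h hq hr ih =>
    have := acceptsIn_record (m := some (s, t)) R (C.y, C.p) (by simpa [afterAnswer, hq] using ih hb)
    rw [transcript_cons, List.length_append, List.append_assoc, add_right_comm k 1,
      add_comm (record _ _).length, ← add_assoc]
    exact acceptsIn_of_move (.ask _ s t h) this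

theorem acceptsIn_skipBits (y : List Bool)
    (h : (verifier M).AcceptsIn j (vconfig M .ready S a (y.reverse ++ r) u)) :
    (verifier M).AcceptsIn (j + y.length) (vconfig M .ready S a r u) := by
  induction y generalizing r with
  | nil => exact h
  | cons b y ih =>
    refine acceptsIn_of_move (.skipBit b) (ih ?_)
    simpa [StackOp.apply] using h

theorem acceptsIn_skipParams (p : ℕ)
    (h : (verifier M).AcceptsIn j (vconfig M .ready S a r (List.replicate p true))) :
    (verifier M).AcceptsIn (j + p) (vconfig M .ready S a r []) := by
  induction p generalizing j with
  | zero => exact h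
  | succ p ih =>
    rw [← add_assoc, add_right_comm]
    exact ih (acceptsIn_of_move .skipParam h)

/-- Guessing a query and starting to fetch costs at most the length of its record, and reading the
record costs that length again; hence the factor 2. -/
theorem acceptsIn_skip (R : Set (List Bool × ℕ)) (qs : List (List Bool × ℕ))
    (h : (verifier M).AcceptsIn j (vconfig M .ready S a [] [])) :
    ∃ i ≤ j + 2 * (transcript R qs).length, (verifier M).AcceptsIn i
      (vconfig M .ready S (transcript R qs ++ a) [] []) := by
  induction qs with
  | nil => exact ⟨j, le_rfl, h⟩
  | cons q qs ih =>
    obtain ⟨i, hi, hacc⟩ := ih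
    rw [transcript_cons, List.append_assoc]
    have h₁ := acceptsIn_of_move .skip (acceptsIn_record (m := none) R q hacc)
    refine ⟨_, ?_, acceptsIn_skipParams q.2 (acceptsIn_skipBits q.1 (by simpa using h₁))⟩
    simp only [List.length_append, length_record]
    omega

theorem acceptsIn_load {l : List Bool}
    (h : (verifier M).AcceptsIn j (vconfig M .ready
      (Function.update (fun _ => []) M.input (r.reverse ++ l)) a [] [])) :
    (verifier M).AcceptsIn (j + 1 + r.length)
      (vconfig M .load (Function.update (fun _ => []) M.input l) a r []) := by
  induction r generalizing l with
  | nil => exact acceptsIn_of_move (.loadEnd rfl) h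
  | cons b r ih =>
    have key := ih (l := b :: l) (by simpa using h)
    have hl : Function.update (fun _ => []) M.input (b :: l) = fun i : M.Stack =>
        (Function.update (fun _ => StackOp.keep) M.input (StackOp.push b) i).apply
          (Function.update (fun _ => []) M.input l i) := by
      funext i
      by_cases hi : i = M.input
      · subst hi; simp [StackOp.apply]
      · simp [hi, StackOp.apply]
    rw [hl] at key
    exact acceptsIn_of_move (.load b rfl) key

theorem acceptsIn_guess {d : Bool} (z : List Bool)
    (h : (verifier M).AcceptsIn j
      (vconfig M (.boundary d) S a ((delimit z).reverse ++ r) u)) :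
    (verifier M).AcceptsIn (j + (delimit z).length) (vconfig M (.guess d) S a r u) := by
  induction z generalizing r with
  | nil => exact acceptsIn_of_move (.guessEnd d) h
  | cons b z ih =>
    refine acceptsIn_of_move (.guessMore d) (acceptsIn_of_move (.guessBit d b) (ih ?_))
    simpa [StackOp.apply] using h

theorem acceptsIn_boundary {d : Bool} (xs : List (List Bool))
    (h : (verifier M).AcceptsIn j
      (vconfig M (.boundary d) S a ((encodeSeq xs).reverse ++ r) u)) :
    (verifier M).AcceptsIn (j + (encodeSeq xs).length + xs.length)
      (vconfig M (.boundary d) S a r u) := by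
  induction xs generalizing r with
  | nil => exact h
  | cons x xs ih =>
    have := acceptsIn_of_move (S := S) (a := a) (u := u) (.guessString d) (acceptsIn_guess x (r := r)
      (ih (by simpa using h)))
    convert this using 1
    simp
    omega

theorem acceptsIn_copy (z : List Bool)
    (h : (verifier M).AcceptsIn j
      (vconfig M (.boundary true) S a ((delimit z).reverse ++ r) u)) :
    (verifier M).AcceptsIn (j + (delimit z).length) (vconfig M .copy S (delimit z ++ a) r u) := by
  induction z generalizing r with
  | nil => exact acceptsIn_of_move (.copyEnd rfl) h
  | cons b z ih =>
    refine acceptsIn_of_move (.copyMore rfl) (acceptsIn_of_move (.copyBit b rfl) (ih ?_))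
    simpa [StackOp.apply] using h

/-- The records of `qs₁` are skipped, those of `qs` answer the simulation, those of `qs₂` remain
unread. The sequence costs its code length once for writing, once for loading, and at most once more
for one extra step per guessed string. The 4 counts `copyString`, `startLoad`, `loadEnd` and
`startSim`. -/
theorem acceptsIn_pair {R : Set (List Bool × ℕ)} {xs : List (List Bool)} {x : List Bool}
    (hx : x ∈ xs) {k : ℕ} (qs₁ qs qs₂ : List (List Bool × ℕ))
    (h : M.Run R (M.init (encodeSeq xs)) k qs false) :
    ∃ i ≤ k + 3 * (encodeSeq xs).length + 2 * (transcript R (qs₁ ++ qs ++ qs₂)).length + 4,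
      (verifier M).AcceptsIn i
        ((verifier M).init (pair x (transcript R (qs₁ ++ qs ++ qs₂)))) := by
  obtain ⟨pre, post, rfl⟩ := List.append_of_mem hx
  have h₁ := acceptsIn_of_move (.startSim rfl rfl) (acceptsIn_sim (a := transcript R qs₂) h rfl)
  obtain ⟨i, hi, h₂⟩ := acceptsIn_skip R qs₁ h₁
  have h₃ := acceptsIn_of_move .startLoad (acceptsIn_load
    (r := (encodeSeq (pre ++ x :: post)).reverse) (l := [])
    (by simpa [StackOp.apply, OracleMachine.init] using h₂))
  have h₄ := acceptsIn_boundary post (r := (encodeSeq (pre ++ [x])).reverse)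
    (by simpa [encodeSeq_append, OracleMachine.init] using h₃)
  have h₅ := acceptsIn_of_move .copyString (acceptsIn_copy x (r := (encodeSeq pre).reverse)
    (by simpa [encodeSeq_append, StackOp.apply] using h₄))
  have h₆ := acceptsIn_boundary pre (r := []) (by simpa using h₅)
  rw [init_verifier, pair]
  refine ⟨_, ?_, by simpa [transcript_append] using h₆⟩
  have := length_le_encodeSeq pre
  have := length_le_encodeSeq post
  simp only [transcript_append, encodeSeq_append, encodeSeq_cons, List.length_append,
    List.length_reverse] at *
  omega

end Completeness

/-! ### Covering the no-instances by few transcripts -/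

/-- The binary strings of length `n`. -/
def stringsOfLength (n : ℕ) : Finset (List Bool) :=
  (Finset.univ : Finset (List.Vector Bool n)).image List.Vector.toList

@[simp] theorem mem_stringsOfLength {n : ℕ} {x : List Bool} :
    x ∈ stringsOfLength n ↔ x.length = n := by
  refine Finset.mem_image.trans ⟨?_, fun hx => ⟨⟨x, hx⟩, Finset.mem_univ _, rfl⟩⟩
  rintro ⟨v, -, rfl⟩
  exact v.toList_length

theorem card_stringsOfLength_le (n : ℕ) : (stringsOfLength n).card ≤ 2 ^ n :=
  Finset.card_image_le.trans (card_vector (α := Bool) n).le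

theorem card_lists_length_lt (t : ℕ) :
    ∃ W : Finset (List Bool), (∀ w, w.length < t → w ∈ W) ∧ W.card < 2 ^ t := by
  refine ⟨(Finset.range t).biUnion stringsOfLength, fun w hw => by simpa using hw, ?_⟩
  calc _ ≤ ∑ i ∈ Finset.range t, (stringsOfLength i).card := Finset.card_biUnion_le
    _ ≤ ∑ i ∈ Finset.range t, 2 ^ i := Finset.sum_le_sum fun i _ => card_stringsOfLength_le i
    _ < 2 ^ t := Nat.geomSum_lt le_rfl (by simp)

/-- Some value of `f` accounts for at least half of the elements of `U`. -/
theorem exists_half_covered {α β : Type*} [DecidableEq α] [DecidableEq β] {t : ℕ} {W : Finset β}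
    (hW : W.card < 2 ^ t) (f : (Fin t → α) → β) {U : Finset α} (hU : U.Nonempty)
    (hf : ∀ v, (∀ i, v i ∈ U) → f v ∈ W) :
    ∃ w, (∃ v, (∀ i, v i ∈ U) ∧ f v = w) ∧ ∃ V ⊆ U, U.card ≤ 2 * V.card ∧
      ∀ x ∈ V, ∃ v, (∀ i, v i ∈ U) ∧ f v = w ∧ ∃ i, v i = x := by
  classical
  let T := Fintype.piFinset fun _ : Fin t => U
  let cov : β → Finset α := fun w =>
    U.filter fun x => ∃ v, (∀ i, v i ∈ U) ∧ f v = w ∧ ∃ i, v i = x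
  have hcov : ∀ w x, x ∈ cov w → ∃ v, (∀ i, v i ∈ U) ∧ f v = w ∧ ∃ i, v i = x :=
    fun w x hx => (Finset.mem_filter.1 hx).2
  -- If every attained value covered less than half of `U`, its fibre would lie in a power of a set
  -- of size below `U.card / 2`. Fewer than `2 ^ t` such fibres cannot exhaust the `U.card ^ t`
  -- tuples.
  by_contra! hne
  have hlt : ∀ w, 2 ^ t * (T.filter fun v => f v = w).card ≤ U.card ^ t := by
    intro w
    by_cases hw : ∃ v, (∀ i, v i ∈ U) ∧ f v = w
    · have h₁ : 2 * (cov w).card < U.card := by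
        by_contra! hc
        obtain ⟨x, hx, hx'⟩ := hne w hw (cov w) (Finset.filter_subset _ _) hc
        obtain ⟨v, hv, hvw, i, hi⟩ := hcov w x hx
        exact hx' v hv hvw i hi
      have h₂ : (T.filter fun v => f v = w) ⊆ Fintype.piFinset fun _ : Fin t => cov w := by
        intro v hv
        simp only [T, Finset.mem_filter, Fintype.mem_piFinset] at hv
        simp only [cov, Finset.mem_filter, Fintype.mem_piFinset]
        exact fun i => ⟨hv.1 i, v, hv.1, hv.2, i, rfl⟩
      calc 2 ^ t * (T.filter fun v => f v = w).card ≤ 2 ^ t * (cov w).card ^ t := by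
            gcongr
            simpa using Finset.card_le_card h₂
        _ = (2 * (cov w).card) ^ t := by rw [mul_pow]
        _ ≤ U.card ^ t := by gcongr
    · rw [Finset.card_eq_zero.2, mul_zero]
      · exact Nat.zero_le _
      · refine Finset.filter_eq_empty_iff.2 fun v hv hvw => hw ⟨v, ?_, hvw⟩
        simpa [T] using hv
  have hT : T.card = ∑ w ∈ W, (T.filter fun v => f v = w).card :=
    Finset.card_eq_sum_card_fiberwise fun v hv => hf v (by simpa [T] using hv)
  have hpos : 0 < U.card ^ t := pow_pos hU.card_pos _
  have : 2 ^ t * U.card ^ t < 2 ^ t * U.card ^ t := by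
    calc 2 ^ t * U.card ^ t = 2 ^ t * T.card := by simp [T]
      _ = ∑ w ∈ W, 2 ^ t * (T.filter fun v => f v = w).card := by rw [hT, Finset.mul_sum]
      _ ≤ W.card * U.card ^ t := by
        simpa using Finset.sum_le_card_nsmul W _ _ fun w _ => hlt w
      _ < 2 ^ t * U.card ^ t := by gcongr
  exact lt_irrefl _ this

/-- Each round discards at least half of `U`, so `m` rounds suffice. Values of `f` are represented
by tuples attaining them, so that actual query lists can be recovered. -/
theorem exists_cover {α β : Type*} [DecidableEq α] [DecidableEq β] {t : ℕ} {W : Finset β}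
    (hW : W.card < 2 ^ t) (f : (Fin t → α) → β) (m : ℕ) {U : Finset α} (hU : U.card < 2 ^ m)
    (hf : ∀ v, (∀ i, v i ∈ U) → f v ∈ W) :
    ∃ vs : List (Fin t → α), vs.length ≤ m ∧ (∀ v ∈ vs, ∀ i, v i ∈ U) ∧
      ∀ x ∈ U, ∃ v, (∀ i, v i ∈ U) ∧ (∃ i, v i = x) ∧ ∃ v' ∈ vs, f v = f v' := by
  induction m generalizing U with
  | zero =>
    obtain rfl : U = ∅ := by simpa using hU
    exact ⟨[], by simp⟩
  | succ m ih =>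
    rcases U.eq_empty_or_nonempty with rfl | hne
    · exact ⟨[], by simp⟩
    obtain ⟨w, ⟨v₀, hv₀, rfl⟩, V, hVU, hV, hcov⟩ := exists_half_covered hW f hne hf
    have hcard := Finset.card_sdiff_add_card_eq_card hVU
    obtain ⟨vs, hlen, hvs, hall⟩ := ih (U := U \ V) (by rw [pow_succ] at hU; omega)
      fun v hv => hf v fun i => (Finset.mem_sdiff.1 (hv i)).1
    refine ⟨v₀ :: vs, by simpa using hlen, ?_, fun x hx => ?_⟩
    · simp only [List.mem_cons, forall_eq_or_imp]
      exact ⟨hv₀, fun v hv i => (Finset.mem_sdiff.1 (hvs v hv i)).1⟩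
    · by_cases hxV : x ∈ V
      · obtain ⟨v, hv, hfv, hi⟩ := hcov x hxV
        exact ⟨v, hv, hi, v₀, by simp, hfv⟩
      · obtain ⟨v, hv, hi, v', hv', hfv⟩ := hall x (Finset.mem_sdiff.2 ⟨hx, hxV⟩)
        exact ⟨v, fun i => (Finset.mem_sdiff.1 (hv i)).1, hi, v', by simp [hv'], hfv⟩

/-- If `b ^ m` strings are queried with total size at most `(b ^ m) ^ (1 - ε) * q`, where
`b = 3 * q + 1`, then this size is less than a third of the number of strings. -/
theorem three_mul_lt_pow {ε : ℝ} {m s q q' : ℕ} (hm : 1 ≤ m) (hε : 1 ≤ m * ε) (hq : q' ≤ q)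
    (hs : (s : ℝ) ≤ (((3 * q + 1) ^ m : ℕ) : ℝ) ^ (1 - ε) * (q' : ℝ)) :
    3 * s < (3 * q + 1) ^ m := by
  obtain ⟨m, rfl⟩ := Nat.exists_eq_add_of_le' hm
  have hb : (1 : ℝ) ≤ 3 * q + 1 := by linarith [(Nat.cast_nonneg q : (0 : ℝ) ≤ q)]
  -- With `m` now lowered by one, the exponent `(m + 1) * (1 - ε)` is at most `m`: one factor `3 * q
  -- + 1` is saved, which exceeds `3 * q`.
  have h₁ : (((3 * q + 1) ^ (m + 1) : ℕ) : ℝ) ^ (1 - ε) ≤ (3 * q + 1 : ℝ) ^ m := by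
    push_cast
    rw [← Real.rpow_natCast, ← Real.rpow_mul (by linarith), ← Real.rpow_natCast]
    refine Real.rpow_le_rpow_of_exponent_le hb ?_
    push_cast at hε ⊢
    linarith
  have h₂ : (s : ℝ) ≤ (3 * q + 1 : ℝ) ^ m * q :=
    hs.trans (mul_le_mul h₁ (by exact_mod_cast hq) (Nat.cast_nonneg _) (by positivity))
  have h₃ : s ≤ (3 * q + 1) ^ m * q := by exact_mod_cast h₂
  have h₄ : 0 < (3 * q + 1) ^ m := by positivity
  rw [pow_succ]
  nlinarith

/-- For every length there is a short list of queries such that its transcript contains the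
transcripts of negative runs for all no-instances of that length. -/
theorem exists_transcript {c : ℕ} (hc : 1 ≤ c) {M : OracleMachine} {L : Set (List Bool)}
    {R : Set (List Bool × ℕ)} (h : IsOracleORDistillation c M L R) :
    ∃ t T : Polynomial ℕ, ∀ n, ∃ qs, (transcript R qs).length ≤ (n + 1) * t.eval n ∧
      ∀ x ∉ L, x.length = n → ∃ xs, x ∈ xs ∧
        (encodeSeq xs).length = t.eval n * (2 * n + 1) ∧
        ∃ qs₁ qs' qs₂, transcript R qs = transcript R (qs₁ ++ qs' ++ qs₂) ∧
        ∃ k ≤ T.eval (encodeSeq xs).length, M.Run R (M.init (encodeSeq xs)) k qs' false := by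
  classical
  obtain ⟨ε, hε, q, T, hM⟩ := h
  obtain ⟨m, hm⟩ := exists_nat_gt (1 / ε)
  have hm₁ : 1 ≤ m := by
    have : (0 : ℝ) < m := lt_trans (by positivity) hm
    exact_mod_cast this
  have hmε : 1 ≤ m * ε := ((div_lt_iff₀ hε).1 hm).le
  refine ⟨(3 * q + 1) ^ m, T, fun n => ?_⟩
  have ht : ((3 * q + 1) ^ m : Polynomial ℕ).eval n = (3 * q.eval n + 1) ^ m := by simp
  rw [ht]
  set t := (3 * q.eval n + 1) ^ m with t_def
  have htpos : 0 < t := by positivity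
  have hrun := fun v : Fin t → List Bool => hM (List.ofFn v) (by
    rw [Ne, List.ofFn_eq_nil_iff]; exact htpos.ne')
  choose k qs b hr hk hsize hb using hrun
  let U := (stringsOfLength n).filter (· ∉ L)
  have hU : ∀ x, x ∈ U ↔ x.length = n ∧ x ∉ L := fun x => by simp [U]
  have hUcard : U.card < 2 ^ (n + 1) :=
    ((Finset.card_filter_le _ _).trans (card_stringsOfLength_le n)).trans_lt
      (Nat.pow_lt_pow_right (by norm_num) (by omega))
  have hlen : ∀ v : Fin t → List Bool, (∀ i, v i ∈ U) → ∀ y ∈ List.ofFn v, y.length = n := by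
    intro v hv y hy
    obtain ⟨i, rfl⟩ := List.mem_ofFn.1 hy
    exact ((hU _).1 (hv i)).1
  have hshort : ∀ v : Fin t → List Bool, (∀ i, v i ∈ U) → (transcript R (qs v)).length < t := by
    intro v hv
    refine lt_of_le_of_lt (length_transcript_le hc R (qs v)) ?_
    refine three_mul_lt_pow hm₁ hmε
      (eval_le_eval q (maxLength_le fun y hy => (hlen v hv y hy).le)) ?_
    simpa [← t_def] using hsize v
  obtain ⟨W, hW, hWcard⟩ := card_lists_length_lt t
  obtain ⟨vs, hvs, hvsU, hcov⟩ := exists_cover hWcard (fun v => transcript R (qs v)) (n + 1)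
    hUcard fun v hv => hW _ (hshort v hv)
  refine ⟨vs.flatMap qs, ?_, fun x hxL hxn => ?_⟩
  · refine le_trans ?_ (Nat.mul_le_mul_right t hvs)
    clear hvs hcov
    induction vs with
    | nil => simp [transcript]
    | cons v vs ih =>
      have h₁ := ih fun v' hv' => hvsU v' (by simp [hv'])
      have h₂ := hshort v (hvsU v (by simp))
      rw [List.flatMap_cons, transcript_append, List.length_append, List.length_cons, add_mul]
      omega
  · obtain ⟨v, hv, ⟨i, hi⟩, v', hv', hvv'⟩ := hcov x ((hU x).2 ⟨hxn, hxL⟩)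
    obtain ⟨l₁, l₂, rfl⟩ := List.append_of_mem hv'
    have hbv : b v = false := by
      rw [← Bool.not_eq_true, hb]
      rintro ⟨y, hy, hyL⟩
      obtain ⟨j, rfl⟩ := List.mem_ofFn.1 hy
      exact ((hU _).1 (hv j)).2 hyL
    refine ⟨List.ofFn v, List.mem_ofFn.2 ⟨i, hi⟩, ?_, l₁.flatMap qs, qs v, l₂.flatMap qs, ?_,
      k v, hk v, hbv ▸ hr v⟩
    · rw [length_encodeSeq (hlen v hv), List.length_ofFn]
    · simp only [transcript_append, List.flatMap_append, List.flatMap_cons]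
      -- The advice was built from `v'`, but the verifier sees only bits, so equality of transcripts
      -- lets it simulate the run on `v`.
      rw [show transcript R (qs v) = transcript R (qs v') from hvv', List.append_assoc]

/-! ### Membership in coNP/poly -/

theorem mem_slashPoly_coNP {c : ℕ} (hc : 1 ≤ c) {M : OracleMachine} {L : Set (List Bool)}
    {R : Set (List Bool × ℕ)} (h : IsOracleORDistillation c M L R) : L ∈ slashPoly coNP := by
  obtain ⟨t, T, hadv⟩ := exists_transcript hc h
  choose qs hlen hcov using hadv
  -- `e` is the code length of `t` strings of length `n`. It is evaluated at the length of the whole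
  -- input, which exceeds `n`; this is harmless by monotonicity.
  let e : Polynomial ℕ := t * (2 * Polynomial.X + 1)
  let p : Polynomial ℕ := T.comp e + 3 * e + 2 * Polynomial.X + 4
  refine ⟨{w | ∃ k ≤ p.eval w.length, (verifier M).AcceptsIn k ((verifier M).init w)}ᶜ, ?_,
    fun n => transcript R (qs n), (Polynomial.X + 1) * t, fun n => by simpa using hlen n,
    fun x => ?_⟩
  · exact ⟨verifier M, p, fun w => by rw [compl_compl]; rfl⟩
  rw [← not_iff_not, Set.mem_compl_iff, not_not]
  constructor
  · intro hx
    obtain ⟨xs, hxs, hlen_xs, qs₁, qs', qs₂, hqs, k, hk, hr⟩ := hcov x.length x hx rfl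
    obtain ⟨i, hi, hacc⟩ := acceptsIn_pair hxs qs₁ qs' qs₂ hr
    rw [← hqs] at hi hacc
    refine ⟨i, hi.trans ?_, hacc⟩
    have hw : (pair x (transcript R (qs x.length))).length =
        2 * x.length + 1 + (transcript R (qs x.length)).length := by
      simp [pair, length_delimit]
    have he : (encodeSeq xs).length ≤ e.eval (pair x (transcript R (qs x.length))).length := by
      refine le_trans ?_ (eval_le_eval e (m := x.length) (by omega))
      simp [e, hlen_xs]
    have hT := hk.trans (eval_le_eval T he)
    simp only [p, Polynomial.eval_add, Polynomial.eval_mul, Polynomial.eval_comp,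
      Polynomial.eval_X, Polynomial.eval_ofNat]
    omega
  · rintro ⟨k, -, hacc⟩
    -- The guessed sequence may have any length and any entries, since the distillation is correct
    -- on all nonempty sequences.
    refine of_acceptsIn (R := R) (fun xs hxs k qs hr hxL => ?_) ⟨_, rfl⟩ hacc
    obtain ⟨ε, -, q, T, hM⟩ := h
    obtain ⟨k', qs', b, hr', -, -, hb⟩ := hM xs (List.ne_nil_of_mem hxs)
    exact Bool.false_ne_true ((hr.unique hr').trans (hb.2 ⟨x, hxs, hxL⟩))

end OracleOR

theorem theorem5 (c : ℕ) (hc : 1 ≤ c) (L : Set (List Bool)) (R : Set (List Bool × ℕ))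
    (h : ∃ M : OracleOR.OracleMachine, OracleOR.IsOracleORDistillation c M L R) :
    L ∈ OracleOR.slashPoly OracleOR.coNP := by
  obtain ⟨M, hM⟩ := h
  exact OracleOR.mem_slashPoly_coNP hc hM
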